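/- \textbf{Theorem.} Let $\Omega\subset\mathbb R^3$ be a bounded domain (nonempty, open, connected) with Lipschitz boundary, and let $K=\operatorname{diag}(\kappa_1,\kappa_2,\kappa_3)$, where $\kappa_1,\kappa_2,\kappa_3$ are real-valued functions that are continuous on $\overline\Omega$. Let $H_0^1(\Omega)$ be the Sobolev space of complex-valued functions obtained as the closure of $C_c^\infty(\Omega)$ in $H^1(\Omega)$, let $H^{-1}(\Omega)$ be its dual space, and define the bounded operators $\mathcal L,\mathcal A\colon H_0^1(\Omega)\to H^{-1}(\Omega)$ by $$\langle\mathcal L u,v\rangle=\int_\Omega\nabla v\cdot\nabla u,\qquad \langle\mathcal A u,v\rangle=\int_\Omega\nabla v\cdot K\nabla u,\qquad u,v\in H_0^1(\Omega),$$ where $a\cdot b=\sum_{i=1}^3a_ib_i$. Then $\mathcal L$ has a bounded inverse, and the spectrum of the operator $\mathcal L^{-1}\mathcal A\colon H_0^1(\Omega)\to H_0^1(\Omega)$, that is, the set of all $\lambda\in\mathbb C$ for which $\lambda\mathcal I-\mathcal L^{-1}\mathcal A$ does not have a bounded inverse, is $$\operatorname{sp}(\mathcal L^{-1}\mathcal A)=\operatorname{Conv}\bigl(\kappa_1(\overline\Omega)\cup\kappa_2(\overline\Omega)\cup\kappa_3(\overline\Omega)\bigr)\subset\mathbb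 R\subset\mathbb C .$$ -/

import Mathlib

open MeasureTheory Topology
open scoped ContDiff ENNReal NNReal

noncomputable section

namespace GenSpectrum

/-- Three-dimensional Euclidean space. -/
abbrev R3 : Type := EuclideanSpace ℝ (Fin 3)

/-- The space in which gradients of complex-valued functions take their values. -/
abbrev C3 : Type := EuclideanSpace ℂ (Fin 3)

/-- `Ω` has a Lipschitz boundary: near each boundary point `p`, in suitable orthonormal coordinates
centred at `p`, the set `Ω` is the part of space strictly above the graph of a Lipschitz function
of two variables. -/
def HasLipschitzBoundary (Ω : Set R3) : Prop :=
  ∀ p ∈ frontier Ω, ∃ (e : R3 ≃ₗᵢ[ℝ] R3) (C : ℝ≥0) (f : EuclideanSpace ℝ (Fin 2) → ℝ),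
    LipschitzWith C f ∧
      ∀ᶠ x in 𝓝 p, (x ∈ Ω ↔ f !₂[e (x - p) 0, e (x - p) 1] < e (x - p) 2)

/-- A bounded Lipschitz domain: a nonempty, open, connected, bounded set with
Lipschitz boundary. -/
structure IsBoundedLipschitzDomain (Ω : Set R3) : Prop where
  isOpen : IsOpen Ω
  isConnected : IsConnected Ω
  isBounded : Bornology.IsBounded Ω
  lipschitz : HasLipschitzBoundary Ω

/-- Test functions: complex-valued smooth functions whose support is a compact subset of `Ω`. -/
structure IsTestFunction (Ω : Set R3) (φ : R3 → ℂ) : Prop where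
  contDiff : ContDiff ℝ ∞ φ
  hasCompactSupport : HasCompactSupport φ
  tsupport_subset : tsupport φ ⊆ Ω

/-- The classical partial derivative `∂φ/∂xᵢ`. -/
def pderiv (i : Fin 3) (φ : R3 → ℂ) (x : R3) : ℂ :=
  fderiv ℝ φ x (EuclideanSpace.single i 1)

/-- `L²(Ω; ℂ)`. -/
abbrev L2 (Ω : Set R3) : Type := Lp ℂ 2 (volume.restrict Ω)

/-- `L²(Ω; ℂ³)`. -/
abbrev L2Vec (Ω : Set R3) : Type := Lp C3 2 (volume.restrict Ω)

/-- `g` is the weak (distributional) gradient of `u` in `Ω`. -/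
def HasWeakGradient (Ω : Set R3) (u : L2 Ω) (g : L2Vec Ω) : Prop :=
  ∀ φ : R3 → ℂ, IsTestFunction Ω φ → ∀ i : Fin 3,
    ∫ x in Ω, u x * pderiv i φ x = -∫ x in Ω, g x i * φ x

section helpers

variable {Ω : Set R3}

theorem IsTestFunction.add {φ ψ : R3 → ℂ} (hφ : IsTestFunction Ω φ) (hψ : IsTestFunction Ω ψ) :
    IsTestFunction Ω (φ + ψ) :=
  ⟨hφ.contDiff.add hψ.contDiff, hφ.hasCompactSupport.add hψ.hasCompactSupport,
    (tsupport_add φ ψ).trans (Set.union_subset hφ.tsupport_subset hψ.tsupport_subset)⟩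

theorem IsTestFunction.const_smul {φ : R3 → ℂ} (c : ℂ) (hφ : IsTestFunction Ω φ) :
    IsTestFunction Ω (c • φ) :=
  ⟨contDiff_const.smul hφ.contDiff, hφ.hasCompactSupport.mono' (by
      intro x hx
      refine subset_tsupport _ ?_
      simp only [Function.mem_support, Pi.smul_apply, smul_eq_mul] at hx ⊢
      exact right_ne_zero_of_mul hx),
    (closure_mono (by
      intro x hx
      simp only [Function.mem_support, Pi.smul_apply, smul_eq_mul] at hx ⊢
      exact right_ne_zero_of_mul hx)).trans hφ.tsupport_subset⟩

theorem IsTestFunction.zero : IsTestFunction Ω 0 :=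
  ⟨contDiff_const, HasCompactSupport.zero, by simp⟩

theorem IsTestFunction.memLp {φ : R3 → ℂ} (hφ : IsTestFunction Ω φ) :
    MemLp φ 2 (volume.restrict Ω) :=
  (hφ.contDiff.continuous.memLp_of_hasCompactSupport hφ.hasCompactSupport).restrict Ω

theorem IsTestFunction.memLp_pderiv {φ : R3 → ℂ} (hφ : IsTestFunction Ω φ) (i : Fin 3) :
    MemLp (pderiv i φ) 2 (volume.restrict Ω) := by
  have hc : Continuous (pderiv i φ) :=
    (hφ.contDiff.continuous_fderiv (by simp)).clm_apply continuous_const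
  have hs : HasCompactSupport (pderiv i φ) :=
    hφ.hasCompactSupport.fderiv_apply (𝕜 := ℝ) (v := EuclideanSpace.single i 1)
  exact (hc.memLp_of_hasCompactSupport hs).restrict Ω

theorem memLp_coord (g : L2Vec Ω) (i : Fin 3) :
    MemLp (fun x => g x i) 2 (volume.restrict Ω) :=
  (EuclideanSpace.proj (𝕜 := ℂ) i : C3 →L[ℂ] ℂ).comp_memLp' (Lp.memLp g)

theorem HasWeakGradient.add {u v : L2 Ω} {g h : L2Vec Ω}
    (hu : HasWeakGradient Ω u g) (hv : HasWeakGradient Ω v h) :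
    HasWeakGradient Ω (u + v) (g + h) := by
  intro φ hφ i
  have e1 : ∫ x in Ω, (u + v : L2 Ω) x * pderiv i φ x
      = ∫ x in Ω, (u x * pderiv i φ x + v x * pderiv i φ x) := by
    refine integral_congr_ae ?_
    filter_upwards [Lp.coeFn_add u v] with x hx
    rw [hx, Pi.add_apply, add_mul]
  have e2 : ∫ x in Ω, (g + h : L2Vec Ω) x i * φ x
      = ∫ x in Ω, (g x i * φ x + h x i * φ x) := by
    refine integral_congr_ae ?_
    filter_upwards [Lp.coeFn_add g h] with x hx
    rw [hx, Pi.add_apply, PiLp.add_apply, add_mul]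
  have e3 := integral_add ((Lp.memLp u).integrable_mul (hφ.memLp_pderiv i))
    ((Lp.memLp v).integrable_mul (hφ.memLp_pderiv i))
  have e4 := integral_add ((memLp_coord g i).integrable_mul hφ.memLp)
    ((memLp_coord h i).integrable_mul hφ.memLp)
  simp only [Pi.mul_apply] at e3 e4
  rw [e1, e2, e3, e4, hu φ hφ i, hv φ hφ i]
  ring

theorem HasWeakGradient.const_smul {u : L2 Ω} {g : L2Vec Ω} (c : ℂ)
    (hu : HasWeakGradient Ω u g) : HasWeakGradient Ω (c • u) (c • g) := by
  intro φ hφ i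
  have e1 : ∫ x in Ω, (c • u : L2 Ω) x * pderiv i φ x
      = ∫ x in Ω, c * (u x * pderiv i φ x) := by
    refine integral_congr_ae ?_
    filter_upwards [Lp.coeFn_smul c u] with x hx
    rw [hx, Pi.smul_apply, smul_eq_mul, mul_assoc]
  have e2 : ∫ x in Ω, (c • g : L2Vec Ω) x i * φ x
      = ∫ x in Ω, c * (g x i * φ x) := by
    refine integral_congr_ae ?_
    filter_upwards [Lp.coeFn_smul c g] with x hx
    rw [hx, Pi.smul_apply, PiLp.smul_apply, smul_eq_mul, mul_assoc]
  rw [e1, e2, integral_const_mul, integral_const_mul, hu φ hφ i]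
  ring

theorem HasWeakGradient.zero : HasWeakGradient Ω 0 0 := by
  intro φ hφ i
  have e1 : ∫ x in Ω, (0 : L2 Ω) x * pderiv i φ x = 0 := by
    refine integral_eq_zero_of_ae ?_
    filter_upwards [Lp.coeFn_zero ℂ 2 (volume.restrict Ω)] with x hx
    rw [hx]
    simp
  have e2 : ∫ x in Ω, (0 : L2Vec Ω) x i * φ x = 0 := by
    refine integral_eq_zero_of_ae ?_
    filter_upwards [Lp.coeFn_zero C3 2 (volume.restrict Ω)] with x hx
    rw [hx]
    simp
  rw [e1, e2, neg_zero]

end helpers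

/-- The Sobolev space `H¹(Ω)` of complex-valued functions, realised as the graph of the weak
gradient, i.e. the pairs `(u, ∇u)` in `L²(Ω) × L²(Ω)³`, with the norm
`(‖u‖² + ‖∇u‖²)^(1/2)`. -/
def H1 (Ω : Set R3) : Submodule ℂ (WithLp 2 (L2 Ω × L2Vec Ω)) where
  carrier := {p | HasWeakGradient Ω p.fst p.snd}
  add_mem' hp hq := HasWeakGradient.add hp hq
  zero_mem' := HasWeakGradient.zero
  smul_mem' c _ hp := HasWeakGradient.const_smul c hp

/-- The image of the test functions on `Ω` in `H¹(Ω)`. -/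
def testSubspace (Ω : Set R3) : Submodule ℂ (WithLp 2 (L2 Ω × L2Vec Ω)) where
  carrier := {p | p ∈ H1 Ω ∧ ∃ φ : R3 → ℂ, IsTestFunction Ω φ ∧ p.fst =ᵐ[volume.restrict Ω] φ}
  add_mem' := by
    rintro p q ⟨hp1, φ, hφ, hp⟩ ⟨hq1, ψ, hψ, hq⟩
    exact ⟨add_mem hp1 hq1, φ + ψ, hφ.add hψ, (Lp.coeFn_add p.fst q.fst).trans (hp.add hq)⟩
  zero_mem' := ⟨zero_mem _, 0, IsTestFunction.zero, Lp.coeFn_zero _ _ _⟩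
  smul_mem' := by
    rintro c p ⟨hp1, φ, hφ, hp⟩
    exact ⟨Submodule.smul_mem _ c hp1, c • φ, hφ.const_smul c,
      (Lp.coeFn_smul c p.fst).trans (hp.const_smul c)⟩

/-- `H₀¹(Ω)`: the closure of the test functions in `H¹(Ω)`. -/
def H10 (Ω : Set R3) : Submodule ℂ (WithLp 2 (L2 Ω × L2Vec Ω)) :=
  (testSubspace Ω).topologicalClosure

theorem isClosed_H1 (Ω : Set R3) : IsClosed (H1 Ω : Set (WithLp 2 (L2 Ω × L2Vec Ω))) := by
  have hset : (H1 Ω : Set (WithLp 2 (L2 Ω × L2Vec Ω))) =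
      ⋂ (φ : R3 → ℂ) (_ : IsTestFunction Ω φ) (i : Fin 3),
        {p | ∫ x in Ω, p.fst x * pderiv i φ x = -∫ x in Ω, p.snd x i * φ x} := by
    ext p
    simp only [Set.mem_iInter]
    exact Iff.rfl
  rw [hset]
  refine isClosed_iInter fun φ => isClosed_iInter fun hφ => isClosed_iInter fun i => ?_
  have hD := (hφ.memLp_pderiv i).star
  have hS : MemLp (fun x => (EuclideanSpace.single i (star φ x) : C3)) 2 (volume.restrict Ω) := by
    have := hφ.memLp.star
    refine this.of_le ?_ ?_
    · have hc : Continuous fun z : ℂ => (EuclideanSpace.single i z : C3) :=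
        (PiLp.continuous_toLp 2 _).comp (continuous_single (A := fun _ => ℂ) i)
      exact hc.comp_aestronglyMeasurable this.aestronglyMeasurable
    · exact Filter.Eventually.of_forall fun x => by simp
  have e1 : ∀ u : L2 Ω, ∫ x in Ω, u x * pderiv i φ x = inner ℂ (hD.toLp _) u := by
    intro u
    rw [L2.inner_def]
    refine integral_congr_ae ?_
    filter_upwards [hD.coeFn_toLp] with x hx
    rw [hx]
    simp [mul_comm]
  have e2 : ∀ g : L2Vec Ω, ∫ x in Ω, g x i * φ x = inner ℂ (hS.toLp _) g := by
    intro g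
    rw [L2.inner_def]
    refine integral_congr_ae ?_
    filter_upwards [hS.coeFn_toLp] with x hx
    rw [hx]
    simp [EuclideanSpace.inner_single_left, mul_comm]
  simp only [e1, e2]
  exact isClosed_eq (continuous_const.inner (WithLp.prod_continuous_ofLp 2 _ _).fst)
    (continuous_const.inner (WithLp.prod_continuous_ofLp 2 _ _).snd).neg

/-- `H¹(Ω)` is complete, so the closure of the test functions is taken inside `H¹(Ω)`. -/
theorem H10_le_H1 (Ω : Set R3) : H10 Ω ≤ H1 Ω :=
  Submodule.topologicalClosure_minimal _ (fun _ hp => hp.1) (isClosed_H1 Ω)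

/-- The weak gradient of an element of `H₀¹(Ω)`. -/
def grad {Ω : Set R3} (u : H10 Ω) : L2Vec Ω := u.1.snd

/-- The form `∫_Ω ∇v · K ∇u` for `K = diag (κ 0, κ 1, κ 2)`. -/
def form {Ω : Set R3} (κ : Fin 3 → R3 → ℝ) (u v : H10 Ω) : ℂ :=
  ∫ x in Ω, ∑ i, grad v x i * ((κ i x : ℂ) * grad u x i)

section helpers

variable {Ω : Set R3} {κ : Fin 3 → R3 → ℝ}

theorem form_integrable_vec (hκ : ∀ i, MemLp (κ i) ⊤ (volume.restrict Ω)) (g h : L2Vec Ω) :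
    Integrable (fun x => ∑ i, h x i * ((κ i x : ℂ) * g x i)) (volume.restrict Ω) := by
  refine integrable_finsetSum _ fun i _ => ?_
  have h1 : MemLp (fun x => (κ i x : ℂ) * g x i) 2 (volume.restrict Ω) :=
    (memLp_coord g i).mul (hκ i).ofReal
  exact (memLp_coord h i).integrable_mul h1

theorem form_add_left (hκ : ∀ i, MemLp (κ i) ⊤ (volume.restrict Ω)) (u u' v : H10 Ω) :
    form κ (u + u') v = form κ u v + form κ u' v := by
  unfold form
  rw [← integral_add (form_integrable_vec hκ _ _) (form_integrable_vec hκ _ _)]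
  refine integral_congr_ae ?_
  filter_upwards [Lp.coeFn_add (grad u) (grad u')] with x hx
  have hx' : (grad (u + u') : L2Vec Ω) x = grad u x + grad u' x := hx
  simp only [hx', PiLp.add_apply, mul_add, Finset.sum_add_distrib]

theorem form_add_right (hκ : ∀ i, MemLp (κ i) ⊤ (volume.restrict Ω)) (u v v' : H10 Ω) :
    form κ u (v + v') = form κ u v + form κ u v' := by
  unfold form
  rw [← integral_add (form_integrable_vec hκ _ _) (form_integrable_vec hκ _ _)]
  refine integral_congr_ae ?_
  filter_upwards [Lp.coeFn_add (grad v) (grad v')] with x hx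
  have hx' : (grad (v + v') : L2Vec Ω) x = grad v x + grad v' x := hx
  simp only [hx', PiLp.add_apply, add_mul, Finset.sum_add_distrib]

theorem form_smul_left (c : ℂ) (u v : H10 Ω) : form κ (c • u) v = c • form κ u v := by
  unfold form
  rw [← integral_smul]
  refine integral_congr_ae ?_
  filter_upwards [Lp.coeFn_smul c (grad u)] with x hx
  have hx' : (grad (c • u) : L2Vec Ω) x = c • grad u x := hx
  simp only [hx', PiLp.smul_apply, smul_eq_mul, Finset.mul_sum]
  exact Finset.sum_congr rfl fun i _ => by ring

theorem form_smul_right (c : ℂ) (u v : H10 Ω) : form κ u (c • v) = c • form κ u v := by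
  unfold form
  rw [← integral_smul]
  refine integral_congr_ae ?_
  filter_upwards [Lp.coeFn_smul c (grad v)] with x hx
  have hx' : (grad (c • v) : L2Vec Ω) x = c • grad v x := hx
  simp only [hx', PiLp.smul_apply, smul_eq_mul, Finset.mul_sum]
  exact Finset.sum_congr rfl fun i _ => by ring

theorem norm_grad_le (u : H10 Ω) : ‖grad u‖ ≤ ‖u‖ :=
  WithLp.norm_snd_le (p := 2) (L2 Ω) u.1

theorem integral_norm_mul_norm_le (g h : L2Vec Ω) :
    ∫ x in Ω, ‖h x‖ * ‖g x‖ ≤ ‖h‖ * ‖g‖ := by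
  have hp : (2 : ℝ).HolderConjugate 2 := by
    constructor <;> norm_num
  have key := integral_mul_norm_le_Lp_mul_Lq (μ := volume.restrict Ω) (f := h) (g := g) hp
    (by simpa using Lp.memLp h) (by simpa using Lp.memLp g)
  have e : ∀ k : L2Vec Ω, (∫ x in Ω, ‖k x‖ ^ (2 : ℝ)) ^ (1 / (2 : ℝ)) = ‖k‖ := by
    intro k
    rw [Lp.norm_def, (Lp.memLp k).eLpNorm_eq_integral_rpow_norm (by norm_num) (by norm_num),
      ENNReal.toReal_ofReal (by positivity)]
    norm_num
  rwa [e, e] at key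

theorem norm_form_le (hκ : ∀ i, MemLp (κ i) ⊤ (volume.restrict Ω)) (u v : H10 Ω) :
    ‖form κ u v‖ ≤ (∑ i, (eLpNorm (κ i) ⊤ (volume.restrict Ω)).toReal) * ‖u‖ * ‖v‖ := by
  set M : Fin 3 → ℝ := fun i => (eLpNorm (κ i) ⊤ (volume.restrict Ω)).toReal with hM
  have hb : ∀ i, ∀ᵐ x ∂(volume.restrict Ω), ‖κ i x‖ ≤ M i := by
    intro i
    filter_upwards [ae_le_eLpNormEssSup (f := κ i) (μ := volume.restrict Ω)] with x hx
    have h2 : eLpNorm (κ i) ⊤ (volume.restrict Ω) ≠ ⊤ := (hκ i).eLpNorm_ne_top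
    rw [← eLpNorm_exponent_top] at hx
    simpa [hM] using ENNReal.toReal_mono h2 hx
  have hM0 : 0 ≤ ∑ i, M i := Finset.sum_nonneg fun i _ => ENNReal.toReal_nonneg
  have hint : Integrable (fun x => ‖grad v x‖ * ‖grad u x‖) (volume.restrict Ω) :=
    (Lp.memLp (grad v)).norm.integrable_mul (Lp.memLp (grad u)).norm
  calc ‖form κ u v‖
      ≤ ∫ x in Ω, (∑ i, M i) * (‖grad v x‖ * ‖grad u x‖) := by
        refine norm_integral_le_of_norm_le (hint.const_mul _) ?_
        filter_upwards [ae_all_iff.2 hb] with x hx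
        rw [Finset.sum_mul]
        refine (norm_sum_le _ _).trans (Finset.sum_le_sum fun i _ => ?_)
        rw [norm_mul, norm_mul, Complex.norm_real]
        have h1 := PiLp.norm_apply_le (grad v x) i
        have h2 := PiLp.norm_apply_le (grad u x) i
        calc ‖grad v x i‖ * (‖κ i x‖ * ‖grad u x i‖)
            ≤ ‖grad v x‖ * (M i * ‖grad u x‖) := by gcongr; exact hx i
          _ = M i * (‖grad v x‖ * ‖grad u x‖) := by ring
    _ = (∑ i, M i) * ∫ x in Ω, ‖grad v x‖ * ‖grad u x‖ := integral_const_mul _ _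
    _ ≤ (∑ i, M i) * (‖v‖ * ‖u‖) := by
        refine mul_le_mul_of_nonneg_left ((integral_norm_mul_norm_le _ _).trans ?_) hM0
        exact mul_le_mul (norm_grad_le v) (norm_grad_le u) (norm_nonneg _) (norm_nonneg _)
    _ = (∑ i, M i) * ‖u‖ * ‖v‖ := by ring

theorem memLp_top_of_continuousOn_closure {f : R3 → ℝ} (hO : IsOpen Ω)
    (hB : Bornology.IsBounded Ω) (hf : ContinuousOn f (closure Ω)) :
    MemLp f ⊤ (volume.restrict Ω) := by
  obtain ⟨C, hC⟩ := hB.isCompact_closure.exists_bound_of_continuousOn hf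
  refine memLp_top_of_bound
    ((hf.mono subset_closure).aestronglyMeasurable hO.measurableSet) C ?_
  exact (ae_restrict_iff' hO.measurableSet).2
    (Filter.Eventually.of_forall fun x hx => hC x (subset_closure hx))

end helpers

/-- The form `∫_Ω ∇v · K ∇u` as a bilinear map on `H₀¹(Ω)`. -/
def formBilin {Ω : Set R3} (κ : Fin 3 → R3 → ℝ)
    (hκ : ∀ i, MemLp (κ i) ⊤ (volume.restrict Ω)) : H10 Ω →ₗ[ℂ] H10 Ω →ₗ[ℂ] ℂ :=
  LinearMap.mk₂ ℂ (form κ) (form_add_left hκ) form_smul_left (form_add_right hκ)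
    form_smul_right

/-- `H⁻¹(Ω)`: the space of bounded linear functionals on `H₀¹(Ω)`. -/
abbrev Hneg1 (Ω : Set R3) : Type := StrongDual ℂ (H10 Ω)

/-- The operator `𝒜 : H₀¹(Ω) → H⁻¹(Ω)`, `⟨𝒜 u, v⟩ = ∫_Ω ∇v · K ∇u`, for a measurable, essentially
bounded coefficient matrix `K = diag (κ 0, κ 1, κ 2)`. -/
def opA (Ω : Set R3) (κ : Fin 3 → R3 → ℝ) (hκ : ∀ i, MemLp (κ i) ⊤ (volume.restrict Ω)) :
    H10 Ω →L[ℂ] Hneg1 Ω :=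
  LinearMap.mkContinuous₂ (formBilin κ hκ)
    (∑ i, (eLpNorm (κ i) ⊤ (volume.restrict Ω)).toReal) (norm_form_le hκ)

theorem opA_apply (Ω : Set R3) (κ : Fin 3 → R3 → ℝ)
    (hκ : ∀ i, MemLp (κ i) ⊤ (volume.restrict Ω)) (u v : H10 Ω) :
    opA Ω κ hκ u v = ∫ x in Ω, ∑ i, grad v x i * ((κ i x : ℂ) * grad u x i) := rfl

/-- The operator `ℒ : H₀¹(Ω) → H⁻¹(Ω)`, `⟨ℒ u, v⟩ = ∫_Ω ∇v · ∇u`. -/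
def opL (Ω : Set R3) : H10 Ω →L[ℂ] Hneg1 Ω :=
  opA Ω (fun _ _ => 1) fun _ => memLp_top_const 1

theorem opL_apply (Ω : Set R3) (u v : H10 Ω) :
    opL Ω u v = ∫ x in Ω, ∑ i, grad v x i * grad u x i := by
  simp [opL, opA_apply]

/-- The preconditioned operator `ℒ⁻¹𝒜 : H₀¹(Ω) → H₀¹(Ω)`. (`ContinuousLinearMap.inverse` is the
bounded inverse of an invertible operator.) -/
def precond (Ω : Set R3) (κ : Fin 3 → R3 → ℝ)
    (hκ : ∀ i, MemLp (κ i) ⊤ (volume.restrict Ω)) : H10 Ω →L[ℂ] H10 Ω :=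
  (opL Ω).inverse ∘L opA Ω κ hκ

end GenSpectrum

end

/-!
Both claims concern the bilinear forms `∫ ∇v · D ∇u` on `H₀¹(Ω)` with `D` diagonal: `ℒ` has
`D = I`, and `l` lies in the spectrum of `ℒ⁻¹𝒜` exactly when `l ℒ - 𝒜`, which has `D = l I - K`,
is not invertible (`mem_spectrum_precond_iff`).

*Invertibility.* If a real linear functional `f` satisfies `f (dᵢ x) ≥ δ > 0` for all entries of
`D`, testing with `v = ū` gives `f (∫ ∇ū · D ∇u) ≥ δ ‖∇u‖²`, and the Poincaré inequality together
with a Lax–Milgram argument for symmetric bilinear forms yields a bounded inverse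
(`isInvertible_of_halfPlane`). This covers `ℒ`, and, by separating `l` from the interval spanned
by the values of the `κᵢ`, all `l` outside the convex hull.

*Non-invertibility.* Since the closure of `Ω` is connected, every point of the hull is a real `r`
with `κᵢ(p) ≤ r ≤ κⱼ(p)` at one single point `p` of the closure
(`exists_between_of_mem_convexHull`). Hence some real `ξ ≠ 0` is isotropic for `r I - K(p)`, and
the functions `uₙ = ψ exp (i n ξ·x)`, with `ψ` a bump supported near `p`, have
`‖uₙ‖ → ∞` while `(r ℒ - 𝒜) uₙ` stays bounded up to a small multiple of `‖uₙ‖`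
(`exists_bound_isotropic`, `norm_shift_toH10_le`). The cancellation behind this bound is that the
symbol `ξ · (r I - K(p)) ξ` vanishes. So `r ℒ - 𝒜` is not bounded below
(`not_isInvertible_shift`). The regularity of the boundary of `Ω` plays no role.
-/

noncomputable section

namespace GenSpectrum

open scoped ComplexConjugate InnerProductSpace

/-! ### Symmetric bilinear forms on a Hilbert space -/

/-- A variant of the Lax–Milgram theorem for a bilinear (rather than sesquilinear) form. -/
theorem isInvertible_of_symm_of_coercive {H : Type*} [NormedAddCommGroup H]
    [InnerProductSpace ℂ H] [CompleteSpace H] (B : H →L[ℂ] StrongDual ℂ H)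
    (hsymm : ∀ u v, B u v = B v u) {c : ℝ} (hc : 0 < c)
    (hB : ∀ u, ∃ v, ‖v‖ ≤ ‖u‖ ∧ c * ‖u‖ ^ 2 ≤ ‖B u v‖) : B.IsInvertible := by
  -- `B` is bounded below, hence injective with closed range.
  have hbound : ∀ u, c * ‖u‖ ≤ ‖B u‖ := by
    intro u
    obtain ⟨v, hv, h⟩ := hB u
    rcases (norm_nonneg u).eq_or_lt with h0 | h0
    · rw [← h0]; simp
    · refine le_of_mul_le_mul_right ?_ h0
      calc c * ‖u‖ * ‖u‖ = c * ‖u‖ ^ 2 := by ring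
        _ ≤ ‖B u v‖ := h
        _ ≤ ‖B u‖ * ‖v‖ := (B u).le_opNorm v
        _ ≤ ‖B u‖ * ‖u‖ := by gcongr
  have hinj : B.ker = ⊥ := by
    rw [LinearMap.ker_eq_bot']
    intro u hu
    have h1 := hbound u
    have hu' : B u = 0 := hu
    rw [hu', norm_zero] at h1
    exact norm_le_zero_iff.1 (nonpos_of_mul_nonpos_right h1 hc)
  have hanti : AntilipschitzWith (Real.toNNReal c⁻¹) B := by
    refine AddMonoidHomClass.antilipschitz_of_bound B fun u => ?_
    rw [Real.coe_toNNReal _ (by positivity), inv_mul_eq_div, le_div_iff₀ hc, mul_comm]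
    exact hbound u
  have hclosed : IsClosed (Set.range B) := hanti.isClosed_range B.uniformContinuous
  let J := InnerProductSpace.toDual ℂ H
  let R : Submodule ℂ H := (LinearMap.range B.toLinearMap).comap
    (J.toLinearEquiv.toLinearMap : H →ₗ⋆[ℂ] StrongDual ℂ H)
  have hRc : IsClosed (R : Set H) := hclosed.preimage J.continuous
  -- A vector orthogonal to the range is annihilated by `B` itself, because `B` is symmetric.
  have hR : R = ⊤ := by
    have : R.HasOrthogonalProjection := by
      have : CompleteSpace R := hRc.completeSpace_coe
      infer_instance
    rw [← Submodule.orthogonal_eq_bot_iff, Submodule.eq_bot_iff]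
    intro w hw
    have h1 : ∀ u, B u w = 0 := by
      intro u
      have hx : J.symm (B u) ∈ R := by
        change J (J.symm (B u)) ∈ LinearMap.range B.toLinearMap
        rw [J.apply_symm_apply]
        exact ⟨u, rfl⟩
      have h2 := (Submodule.mem_orthogonal R w).1 hw _ hx
      rwa [InnerProductSpace.toDual_symm_apply] at h2
    have h3 : B w = 0 := by
      ext u
      rw [hsymm, h1]
      rfl
    exact (LinearMap.ker_eq_bot'.1 hinj) w h3
  have hsurj : B.range = ⊤ := by
    rw [eq_top_iff]
    intro f _
    have h1 : J.symm f ∈ R := hR ▸ Submodule.mem_top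
    have h2 : J (J.symm f) ∈ LinearMap.range B.toLinearMap := h1
    rwa [J.apply_symm_apply] at h2
  exact ⟨ContinuousLinearEquiv.ofBijective B hinj hsurj,
    ContinuousLinearEquiv.coe_ofBijective B hinj hsurj⟩

/-! ### Test functions and their gradients -/

section

variable {Ω : Set R3}

instance : CompleteSpace (H10 Ω) :=
  (Submodule.isClosed_topologicalClosure (testSubspace Ω)).completeSpace_coe

theorem IsTestFunction.pderiv {φ : R3 → ℂ} (hφ : IsTestFunction Ω φ) (i : Fin 3) :
    IsTestFunction Ω (pderiv i φ) where
  contDiff := (hφ.contDiff.fderiv_right (m := ∞) (by simp)).clm_apply contDiff_const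
  hasCompactSupport :=
    hφ.hasCompactSupport.fderiv_apply (𝕜 := ℝ) (v := EuclideanSpace.single i 1)
  tsupport_subset := (tsupport_fderiv_apply_subset ℝ _).trans hφ.tsupport_subset

theorem IsTestFunction.mul_contDiff {φ e : R3 → ℂ} (hφ : IsTestFunction Ω φ)
    (he : ContDiff ℝ ∞ e) : IsTestFunction Ω (fun x => φ x * e x) where
  contDiff := hφ.contDiff.mul he
  hasCompactSupport := hφ.hasCompactSupport.mul_right
  tsupport_subset := (tsupport_mul_subset_left (f := φ) (g := e)).trans hφ.tsupport_subset

theorem IsTestFunction.conj {φ : R3 → ℂ} (hφ : IsTestFunction Ω φ) :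
    IsTestFunction Ω (fun x => conj (φ x)) where
  contDiff := Complex.conjCLE.contDiff.comp hφ.contDiff
  hasCompactSupport := hφ.hasCompactSupport.comp_left (map_zero _)
  tsupport_subset := by
    refine (closure_mono fun x hx => ?_).trans hφ.tsupport_subset
    simpa using hx

theorem pderiv_conj {φ : R3 → ℂ} (hφ : Differentiable ℝ φ) (i : Fin 3) (x : R3) :
    pderiv i (fun x => conj (φ x)) x = conj (pderiv i φ x) := by
  have h := (Complex.conjCLE.toContinuousLinearMap.hasFDerivAt (x := φ x)).comp x
    (hφ x).hasFDerivAt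
  have h' : fderiv ℝ (fun x => conj (φ x)) x = _ := h.fderiv
  simp [pderiv, h']

theorem pderiv_mul {φ ψ : R3 → ℂ} (hφ : Differentiable ℝ φ) (hψ : Differentiable ℝ ψ)
    (i : Fin 3) (x : R3) :
    pderiv i (fun x => φ x * ψ x) x = pderiv i φ x * ψ x + φ x * pderiv i ψ x := by
  have h : fderiv ℝ (fun x => φ x * ψ x) x = _ :=
    ((hφ x).hasFDerivAt.mul (hψ x).hasFDerivAt).fderiv
  simp only [pderiv, h]
  simp
  ring

/-- The classical gradient, as a function with values in `ℂ³`. -/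
def classicalGrad (φ : R3 → ℂ) (x : R3) : C3 := WithLp.toLp 2 fun i => pderiv i φ x

theorem IsTestFunction.memLp_classicalGrad {φ : R3 → ℂ} (hφ : IsTestFunction Ω φ) :
    MemLp (classicalGrad φ) 2 (volume.restrict Ω) := by
  have h1 : Continuous (classicalGrad φ) :=
    (PiLp.continuous_toLp 2 _).comp (continuous_pi fun i => (hφ.pderiv i).contDiff.continuous)
  have h2 : HasCompactSupport (classicalGrad φ) := by
    refine HasCompactSupport.intro hφ.hasCompactSupport fun x hx => ?_
    ext i
    change GenSpectrum.pderiv i φ x = 0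
    exact image_eq_zero_of_notMem_tsupport
      fun h => hx (tsupport_fderiv_apply_subset ℝ (EuclideanSpace.single i 1) h)
  exact (h1.memLp_of_hasCompactSupport h2).restrict Ω

theorem integral_mul_pderiv {φ ψ : R3 → ℂ} (hφ : IsTestFunction Ω φ) (hψ : IsTestFunction Ω ψ)
    (i : Fin 3) : ∫ x in Ω, φ x * pderiv i ψ x = -∫ x in Ω, pderiv i φ x * ψ x := by
  have hint : ∀ {a b : R3 → ℂ}, IsTestFunction Ω a → IsTestFunction Ω b →
      Integrable (fun x => a x * b x) volume := fun ha hb =>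
    (ha.contDiff.continuous.mul hb.contDiff.continuous).integrable_of_hasCompactSupport
      ha.hasCompactSupport.mul_right
  have hset : ∀ {a b : R3 → ℂ}, IsTestFunction Ω a →
      ∫ x in Ω, a x * b x = ∫ x, a x * b x := fun ha =>
    setIntegral_eq_integral_of_forall_compl_eq_zero fun x hx => by
      rw [image_eq_zero_of_notMem_tsupport fun h => hx (ha.tsupport_subset h), zero_mul]
  rw [hset hφ, hset (hφ.pderiv i)]
  exact integral_mul_fderiv_eq_neg_fderiv_mul_of_integrable (hint (hφ.pderiv i) hψ)
    (hint hφ (hψ.pderiv i)) (hint hφ hψ)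
    (fun x _ => hφ.contDiff.differentiable (by simp) x)
    (fun x _ => hψ.contDiff.differentiable (by simp) x)

/-- A test function as an element of `H₀¹(Ω)`. -/
def IsTestFunction.toH10 {φ : R3 → ℂ} (hφ : IsTestFunction Ω φ) : H10 Ω :=
  ⟨WithLp.toLp 2 (hφ.memLp.toLp φ, hφ.memLp_classicalGrad.toLp (classicalGrad φ)), by
    refine Submodule.le_topologicalClosure _ ⟨?_, φ, hφ, hφ.memLp.coeFn_toLp⟩
    intro ψ hψ i
    have e1 : ∫ x in Ω, hφ.memLp.toLp φ x * GenSpectrum.pderiv i ψ x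
        = ∫ x in Ω, φ x * GenSpectrum.pderiv i ψ x := by
      refine integral_congr_ae ?_
      filter_upwards [hφ.memLp.coeFn_toLp] with x hx
      rw [hx]
    have e2 : ∫ x in Ω, hφ.memLp_classicalGrad.toLp (classicalGrad φ) x i * ψ x
        = ∫ x in Ω, GenSpectrum.pderiv i φ x * ψ x := by
      refine integral_congr_ae ?_
      filter_upwards [hφ.memLp_classicalGrad.coeFn_toLp] with x hx
      rw [hx]
      rfl
    exact e1.trans ((integral_mul_pderiv hφ hψ i).trans (congrArg _ e2.symm))⟩

theorem IsTestFunction.grad_toH10 {φ : R3 → ℂ} (hφ : IsTestFunction Ω φ) :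
    grad hφ.toH10 =ᵐ[volume.restrict Ω] classicalGrad φ :=
  hφ.memLp_classicalGrad.coeFn_toLp

/-- Weak gradients are unique, by the fundamental lemma of the calculus of variations. -/
theorem HasWeakGradient.unique (hO : IsOpen Ω) {u : L2 Ω} {g h : L2Vec Ω}
    (hg : HasWeakGradient Ω u g) (hh : HasWeakGradient Ω u h) : g = h := by
  have key : ∀ i, ∀ᵐ x ∂(volume.restrict Ω), g x i - h x i = 0 := by
    intro i
    rw [ae_restrict_iff' hO.measurableSet]
    have hloc : LocallyIntegrableOn (fun x => g x i - h x i) Ω volume :=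
      locallyIntegrableOn_of_locallyIntegrable_restrict
        (((memLp_coord g i).sub (memLp_coord h i)).locallyIntegrable (by norm_num))
    refine hO.ae_eq_zero_of_integral_contDiff_smul_eq_zero hloc fun χ h1 h2 h3 => ?_
    have ht : IsTestFunction Ω (fun x => (χ x : ℂ)) := by
      refine ⟨Complex.ofRealCLM.contDiff.comp h1, h2.comp_left Complex.ofReal_zero, ?_⟩
      refine (closure_mono fun x hx => ?_).trans h3
      simpa using hx
    have e := (hg _ ht i).symm.trans (hh _ ht i)
    have e3 := integral_sub ((memLp_coord g i).integrable_mul ht.memLp)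
      ((memLp_coord h i).integrable_mul ht.memLp)
    simp only [Pi.mul_apply] at e3
    rw [neg_inj.1 e, sub_self] at e3
    rw [← setIntegral_eq_integral_of_forall_compl_eq_zero (s := Ω) fun x hx => by
      rw [image_eq_zero_of_notMem_tsupport fun h => hx (h3 h), zero_smul], ← e3]
    refine integral_congr_ae (.of_forall fun x => ?_)
    simp only [Complex.real_smul]
    ring
  ext1
  filter_upwards [ae_all_iff.2 key] with x hx
  ext i
  exact sub_eq_zero.1 (hx i)

/-! ### The Poincaré inequality -/

theorem norm_fderiv_le_classicalGrad (φ : R3 → ℂ) (x : R3) :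
    ‖fderiv ℝ φ x‖ ≤ 3 * ‖classicalGrad φ x‖ := by
  refine ContinuousLinearMap.opNorm_le_bound _ (by positivity) fun v => ?_
  have hv : v = ∑ i, v i • (EuclideanSpace.single i 1 : R3) := by
    ext j
    fin_cases j <;> simp [Fin.sum_univ_three]
  calc ‖fderiv ℝ φ x v‖ = ‖∑ i, v i • pderiv i φ x‖ := by
        conv_lhs => rw [hv]
        simp [pderiv, map_sum]
    _ ≤ ∑ i : Fin 3, ‖classicalGrad φ x‖ * ‖v‖ := by
        refine (norm_sum_le _ _).trans (Finset.sum_le_sum fun i _ => ?_)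
        rw [norm_smul, mul_comm]
        exact mul_le_mul (PiLp.norm_apply_le (classicalGrad φ x) i) (PiLp.norm_apply_le v i)
          (norm_nonneg _) (norm_nonneg _)
    _ = 3 * ‖classicalGrad φ x‖ * ‖v‖ := by
        rw [Finset.sum_const, Finset.card_univ, Fintype.card_fin, nsmul_eq_mul]
        push_cast
        ring

/-- The bound is the Gagliardo–Nirenberg–Sobolev inequality for test functions (where the weak
gradient is the classical one), and it passes to the closure. -/
theorem exists_norm_le_norm_grad (hO : IsOpen Ω) (hb : Bornology.IsBounded Ω) :
    ∃ C : ℝ, 0 ≤ C ∧ ∀ u : H10 Ω, ‖u.1.fst‖ ≤ C * ‖grad u‖ := by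
  let D : ℝ≥0 := eLpNormLESNormFDerivOfLeConst ℂ (volume : Measure R3) Ω 2 2
  refine ⟨D * 3, by positivity, fun u => ?_⟩
  have hclosed : IsClosed {p : WithLp 2 (L2 Ω × L2Vec Ω) | ‖p.fst‖ ≤ D * 3 * ‖p.snd‖} :=
    isClosed_le (WithLp.prod_continuous_ofLp 2 _ _).fst.norm
      (continuous_const.mul (WithLp.prod_continuous_ofLp 2 _ _).snd.norm)
  refine closure_minimal (s := (testSubspace Ω : Set (WithLp 2 (L2 Ω × L2Vec Ω)))) ?_ hclosed u.2
  rintro p ⟨hp, φ, hφ, hpφ⟩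
  have hfst : p.fst = hφ.toH10.1.fst := by
    ext1
    exact hpφ.trans hφ.memLp.coeFn_toLp.symm
  have hsnd : p.snd = grad hφ.toH10 := by
    refine HasWeakGradient.unique hO hp ?_
    rw [hfst]
    exact H10_le_H1 Ω hφ.toH10.2
  have hφs : ∀ {F : Type} [NormedAddCommGroup F] (f : R3 → F), Function.support f ⊆ tsupport φ →
      eLpNorm f 2 (volume.restrict Ω) = eLpNorm f 2 volume := by
    intro F _ f hf
    rw [← eLpNorm_indicator_eq_eLpNorm_restrict hO.measurableSet,
      Set.indicator_eq_self.2 (hf.trans hφ.tsupport_subset)]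
  have key := eLpNorm_le_eLpNorm_fderiv (F := ℂ) (volume : Measure R3) (u := φ) (s := Ω)
    (p := 2) (hφ.contDiff.of_le (by exact_mod_cast le_top))
    ((subset_tsupport φ).trans hφ.tsupport_subset) (by norm_num)
    (by rw [finrank_euclideanSpace_fin]; norm_num) hb
  have h2 : ((2 : ℝ≥0) : ℝ≥0∞) = 2 := rfl
  rw [h2, ← hφs φ (subset_tsupport φ), ← hφs (fderiv ℝ φ) (support_fderiv_subset ℝ)] at key
  have hgr : eLpNorm (fderiv ℝ φ) 2 (volume.restrict Ω) ≤
      ENNReal.ofReal 3 * eLpNorm (classicalGrad φ) 2 (volume.restrict Ω) :=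
    eLpNorm_le_mul_eLpNorm_of_ae_le_mul
      (.of_forall fun x => norm_fderiv_le_classicalGrad φ x) 2
  change ‖p.fst‖ ≤ D * 3 * ‖p.snd‖
  have e1 : ‖p.fst‖ = (eLpNorm φ 2 (volume.restrict Ω)).toReal := by
    rw [hfst]; exact Lp.norm_toLp φ hφ.memLp
  have e2 : ‖p.snd‖ = (eLpNorm (classicalGrad φ) 2 (volume.restrict Ω)).toReal := by
    rw [hsnd]; exact Lp.norm_toLp _ hφ.memLp_classicalGrad
  have h3 := key.trans (mul_le_mul_right hgr _)
  have h4 := ENNReal.toReal_mono (by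
    exact ENNReal.mul_ne_top ENNReal.coe_ne_top (ENNReal.mul_ne_top ENNReal.ofReal_ne_top
      hφ.memLp_classicalGrad.eLpNorm_ne_top)) h3
  rw [e1, e2]
  rw [ENNReal.toReal_mul, ENNReal.toReal_mul, ENNReal.toReal_ofReal (by norm_num),
    ← mul_assoc] at h4
  exact h4

theorem norm_sq_eq (u : H10 Ω) : ‖u‖ ^ 2 = ‖u.1.fst‖ ^ 2 + ‖grad u‖ ^ 2 :=
  WithLp.prod_norm_sq_eq_of_L2 u.1

/-- The Poincaré inequality: on `H₀¹(Ω)` the norm is controlled by the gradient. -/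
theorem exists_mul_norm_sq_le_norm_grad_sq (hO : IsOpen Ω) (hb : Bornology.IsBounded Ω) :
    ∃ c : ℝ, 0 < c ∧ ∀ u : H10 Ω, c * ‖u‖ ^ 2 ≤ ‖grad u‖ ^ 2 := by
  obtain ⟨C, hC, h⟩ := exists_norm_le_norm_grad hO hb
  refine ⟨(C ^ 2 + 1)⁻¹, by positivity, fun u => ?_⟩
  rw [inv_mul_le_iff₀ (by positivity), norm_sq_eq]
  have := pow_le_pow_left₀ (norm_nonneg _) (h u) 2
  nlinarith

/-! ### Complex conjugation on `H₀¹(Ω)` -/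

/-- Coordinatewise complex conjugation on `ℂ³`. -/
def conjVec (z : C3) : C3 := WithLp.toLp 2 fun i => conj (z i)

theorem isometry_conjVec : Isometry conjVec := by
  refine Isometry.of_dist_eq fun z w => ?_
  simp [EuclideanSpace.dist_eq, conjVec, Complex.dist_conj_conj]

theorem conjVec_zero : conjVec 0 = 0 := by
  ext i
  simp [conjVec]

/-- `H₀¹(Ω)` is stable under complex conjugation. -/
theorem exists_conj (u : H10 Ω) : ∃ v : H10 Ω, ‖v‖ ≤ ‖u‖ ∧
    ∀ᵐ x ∂(volume.restrict Ω), grad v x = conjVec (grad u x) := by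
  let c1 : L2 Ω → L2 Ω := Complex.isometry_conj.lipschitz.compLp (map_zero _)
  let c2 : L2Vec Ω → L2Vec Ω := isometry_conjVec.lipschitz.compLp conjVec_zero
  have hc1 : ∀ f : L2 Ω, c1 f =ᵐ[volume.restrict Ω] fun x => conj (f x) := fun f =>
    Complex.isometry_conj.lipschitz.coeFn_compLp (map_zero _) f
  have hc2 : ∀ f : L2Vec Ω, c2 f =ᵐ[volume.restrict Ω] fun x => conjVec (f x) := fun f =>
    isometry_conjVec.lipschitz.coeFn_compLp conjVec_zero f
  let J : WithLp 2 (L2 Ω × L2Vec Ω) → WithLp 2 (L2 Ω × L2Vec Ω) :=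
    fun p => WithLp.toLp 2 (c1 p.fst, c2 p.snd)
  have hJ : Continuous J := by
    refine (WithLp.prod_continuous_toLp 2 _ _).comp (Continuous.prodMk ?_ ?_)
    · exact (Complex.isometry_conj.lipschitz.continuous_compLp (map_zero _)).comp
        (WithLp.prod_continuous_ofLp 2 _ _).fst
    · exact (isometry_conjVec.lipschitz.continuous_compLp conjVec_zero).comp
        (WithLp.prod_continuous_ofLp 2 _ _).snd
  have hmem : J u.1 ∈ H10 Ω := by
    refine map_mem_closure (s := (testSubspace Ω : Set (WithLp 2 (L2 Ω × L2Vec Ω)))) hJ u.2 ?_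
    rintro p ⟨hp, φ, hφ, hpφ⟩
    refine ⟨fun ψ hψ i => ?_, _, hφ.conj, ?_⟩
    · have h := congrArg conj (hp _ hψ.conj i)
      rw [map_neg, ← integral_conj, ← integral_conj] at h
      have e1 : ∫ x in Ω, c1 p.fst x * GenSpectrum.pderiv i ψ x =
          ∫ x in Ω, conj (p.fst x * GenSpectrum.pderiv i (fun x => conj (ψ x)) x) := by
        refine integral_congr_ae ?_
        filter_upwards [hc1 p.fst] with x hx
        rw [hx, pderiv_conj (hψ.contDiff.differentiable (by simp)), map_mul, Complex.conj_conj]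
      have e2 : ∫ x in Ω, c2 p.snd x i * ψ x = ∫ x in Ω, conj (p.snd x i * conj (ψ x)) := by
        refine integral_congr_ae ?_
        filter_upwards [hc2 p.snd] with x hx
        rw [hx, map_mul, Complex.conj_conj]
        rfl
      exact e1.trans (h.trans (congrArg _ e2.symm))
    · filter_upwards [hpφ, hc1 p.fst] with x hx hx1
      exact hx1.trans (congrArg _ hx)
  refine ⟨⟨J u.1, hmem⟩, ?_, hc2 _⟩
  refine le_of_sq_le_sq ?_ (norm_nonneg _)
  rw [norm_sq_eq, norm_sq_eq]
  have b1 : ‖c1 u.1.fst‖ ≤ ‖u.1.fst‖ := by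
    simpa using Complex.isometry_conj.lipschitz.norm_compLp_le (map_zero _) u.1.fst
  have b2 : ‖c2 (grad u)‖ ≤ ‖grad u‖ := by
    simpa using isometry_conjVec.lipschitz.norm_compLp_le conjVec_zero (grad u)
  exact add_le_add (pow_le_pow_left₀ (norm_nonneg _) b1 2) (pow_le_pow_left₀ (norm_nonneg _) b2 2)

/-! ### Invertibility off the convex hull -/

theorem norm_sq_eq_integral_L2Vec (g : L2Vec Ω) :
    Integrable (fun x => ‖g x‖ ^ 2) (volume.restrict Ω) ∧ ‖g‖ ^ 2 = ∫ x in Ω, ‖g x‖ ^ 2 := by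
  refine ⟨(Lp.memLp g).integrable_norm_pow (by norm_num), ?_⟩
  have h1 : ((‖g‖ ^ 2 : ℝ) : ℂ) = ((∫ x in Ω, ‖g x‖ ^ 2 : ℝ) : ℂ) := by
    rw [← integral_complex_ofReal]
    push_cast
    have h := inner_self_eq_norm_sq_to_K (𝕜 := ℂ) g
    rw [L2.inner_def] at h
    refine h.symm.trans (integral_congr_ae (.of_forall fun x => ?_))
    exact inner_self_eq_norm_sq_to_K (𝕜 := ℂ) (g x)
  exact_mod_cast h1

theorem shift_integrable {κ : Fin 3 → R3 → ℝ} (hκ : ∀ i, MemLp (κ i) ⊤ (volume.restrict Ω))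
    (l : ℂ) (g h : L2Vec Ω) :
    Integrable (fun x => ∑ i, h x i * ((l - κ i x) * g x i)) (volume.restrict Ω) := by
  have h1 := (form_integrable_vec (κ := fun _ _ => 1) (fun _ => memLp_top_const 1) g h).const_mul l
  refine (h1.sub (form_integrable_vec hκ g h)).congr (.of_forall fun x => ?_)
  simp only [Pi.sub_apply, Finset.mul_sum, ← Finset.sum_sub_distrib]
  refine Finset.sum_congr rfl fun i _ => ?_
  push_cast
  ring

/-- The operator `l ℒ - 𝒜` has coefficient matrix `l I - K`. -/
theorem shift_apply {κ : Fin 3 → R3 → ℝ} (hκ : ∀ i, MemLp (κ i) ⊤ (volume.restrict Ω))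
    (l : ℂ) (u v : H10 Ω) :
    (l • opL Ω - opA Ω κ hκ) u v = ∫ x in Ω, ∑ i, grad v x i * ((l - κ i x) * grad u x i) := by
  have h1 := (form_integrable_vec (κ := fun _ _ => 1) (fun _ => memLp_top_const 1)
    (grad u) (grad v)).const_mul l
  change l * opL Ω u v - opA Ω κ hκ u v = _
  rw [opL, opA_apply, opA_apply, ← integral_const_mul,
    ← integral_sub h1 (form_integrable_vec hκ (grad u) (grad v))]
  refine integral_congr_ae (.of_forall fun x => ?_)
  simp only [Finset.mul_sum, ← Finset.sum_sub_distrib]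
  refine Finset.sum_congr rfl fun i _ => ?_
  push_cast
  ring

/-- A form `∫ ∇v · D ∇u` is invertible when the coefficients of `D` stay in a half-plane
`{z | δ ≤ f z}`, `δ > 0`: testing with `v = ū` turns the integrand into `∑ |∂ᵢu|² dᵢ`. -/
theorem isInvertible_of_halfPlane (hO : IsOpen Ω) (hb : Bornology.IsBounded Ω)
    (B : H10 Ω →L[ℂ] Hneg1 Ω) (d : Fin 3 → R3 → ℂ)
    (hint : ∀ u v : H10 Ω,
      Integrable (fun x => ∑ i, grad v x i * (d i x * grad u x i)) (volume.restrict Ω))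
    (hB : ∀ u v, B u v = ∫ x in Ω, ∑ i, grad v x i * (d i x * grad u x i))
    (f : StrongDual ℝ ℂ) {δ : ℝ} (hδ : 0 < δ) (hd : ∀ x ∈ Ω, ∀ i, δ ≤ f (d i x)) :
    B.IsInvertible := by
  obtain ⟨c, hc, hP⟩ := exists_mul_norm_sq_le_norm_grad_sq hO hb
  have hF : 0 < ‖f‖ + 1 := by positivity
  refine isInvertible_of_symm_of_coercive B (fun u v => ?_) (c := δ * c / (‖f‖ + 1))
    (by positivity) fun u => ?_
  · rw [hB, hB]
    refine integral_congr_ae (.of_forall fun x => Finset.sum_congr rfl fun i _ => ?_)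
    ring
  · obtain ⟨v, hv, hgv⟩ := exists_conj u
    refine ⟨v, hv, ?_⟩
    obtain ⟨hi, hn⟩ := norm_sq_eq_integral_L2Vec (grad u)
    have h1 : δ * ‖grad u‖ ^ 2 ≤ f (B u v) := by
      rw [hB, ← f.integral_comp_comm (hint u v), hn, ← integral_const_mul]
      refine integral_mono_ae (hi.const_mul δ) (f.integrable_comp (hint u v)) ?_
      filter_upwards [hgv, ae_restrict_mem hO.measurableSet] with x hx hxΩ
      simp only [EuclideanSpace.norm_sq_eq, Finset.mul_sum, map_sum]
      refine Finset.sum_le_sum fun i _ => ?_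
      have e : grad v x i * (d i x * grad u x i) = (‖grad u x i‖ ^ 2 : ℝ) • d i x := by
        rw [hx, Complex.real_smul]
        push_cast
        rw [← Complex.conj_mul']
        change conj (grad u x i) * _ = _
        ring
      rw [e, map_smul, smul_eq_mul, mul_comm]
      exact mul_le_mul_of_nonneg_left (hd x hxΩ i) (by positivity)
    have h2 : f (B u v) ≤ (‖f‖ + 1) * ‖B u v‖ := by
      refine (le_abs_self _).trans ((f.le_opNorm _).trans ?_)
      gcongr
      linarith
    rw [div_mul_eq_mul_div, div_le_iff₀ hF, mul_comm _ (‖f‖ + 1)]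
    refine le_trans ?_ (h1.trans h2)
    rw [mul_assoc]
    exact mul_le_mul_of_nonneg_left (hP u) hδ.le

theorem opL_isInvertible (hO : IsOpen Ω) (hb : Bornology.IsBounded Ω) :
    (opL Ω).IsInvertible :=
  isInvertible_of_halfPlane hO hb (opL Ω) (fun _ _ => ((1 : ℝ) : ℂ))
    (fun u v => form_integrable_vec (κ := fun _ _ => 1) (fun _ => memLp_top_const 1) _ _)
    (fun u v => opA_apply Ω (fun _ _ => 1) (fun _ => memLp_top_const 1) u v)
    Complex.reCLM one_pos (by simp)

theorem shift_isInvertible_of_notMem (hO : IsOpen Ω) (hb : Bornology.IsBounded Ω)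
    {κ : Fin 3 → R3 → ℝ} (hκ : ∀ i, MemLp (κ i) ⊤ (volume.restrict Ω)) {S : Set ℂ}
    (hS : Convex ℝ S) (hSc : IsClosed S) (hκS : ∀ i, ∀ x ∈ Ω, (κ i x : ℂ) ∈ S)
    {l : ℂ} (hl : l ∉ S) : (l • opL Ω - opA Ω κ hκ).IsInvertible := by
  obtain ⟨f, t, h1, h2⟩ := geometric_hahn_banach_closed_point hS hSc hl
  refine isInvertible_of_halfPlane hO hb _ (fun i x => l - κ i x)
    (fun u v => shift_integrable hκ l _ _) (shift_apply hκ l) f (sub_pos.2 h2)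
    fun x hx i => ?_
  rw [map_sub]
  linarith [h1 _ (hκS i x hx)]

theorem mem_spectrum_precond_iff (hL : (opL Ω).IsInvertible) {κ : Fin 3 → R3 → ℝ}
    (hκ : ∀ i, MemLp (κ i) ⊤ (volume.restrict Ω)) (l : ℂ) :
    l ∈ spectrum ℂ (precond Ω κ hκ) ↔ ¬ (l • opL Ω - opA Ω κ hκ).IsInvertible := by
  obtain ⟨e, he⟩ := hL
  have h1 : algebraMap ℂ (H10 Ω →L[ℂ] H10 Ω) l - precond Ω κ hκ =
      (e.symm : Hneg1 Ω →L[ℂ] H10 Ω) ∘L (l • opL Ω - opA Ω κ hκ) := by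
    ext1 u
    simp only [precond, ← he, ContinuousLinearMap.inverse_equiv]
    simp [Algebra.algebraMap_eq_smul_one]
  rw [spectrum.mem_iff, h1, not_iff_not,
    ← ContinuousLinearMap.isInvertible_equiv_comp (e := e.symm)]
  constructor
  · rintro ⟨a, ha⟩
    exact ⟨ContinuousLinearEquiv.unitsEquiv ℂ _ a, ha⟩
  · rintro ⟨a, ha⟩
    exact ⟨(ContinuousLinearEquiv.unitsEquiv ℂ _).symm a, ha⟩

/-! ### Oscillating test functions -/

/-- The plane wave `x ↦ exp (i ζ·x)`. -/
def planeWave (ζ : Fin 3 → ℝ) (x : R3) : ℂ := Complex.exp (Complex.I * ∑ j, (ζ j : ℂ) * (x j : ℂ))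

theorem norm_planeWave (ζ : Fin 3 → ℝ) (x : R3) : ‖planeWave ζ x‖ = 1 := by
  have : Complex.I * ∑ j, (ζ j : ℂ) * (x j : ℂ) = ((∑ j, ζ j * x j : ℝ) : ℂ) * Complex.I := by
    push_cast
    ring
  rw [planeWave, this, Complex.norm_exp_ofReal_mul_I]

theorem contDiff_planeWave (ζ : Fin 3 → ℝ) : ContDiff ℝ ∞ (planeWave ζ) := by
  have h : ∀ j : Fin 3, ContDiff ℝ ∞ fun x : R3 => ((x j : ℝ) : ℂ) := fun j =>
    Complex.ofRealCLM.contDiff.comp (EuclideanSpace.proj (𝕜 := ℝ) j).contDiff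
  exact (contDiff_const.mul (ContDiff.sum fun j _ => contDiff_const.mul (h j))).cexp

theorem pderiv_planeWave (ζ : Fin 3 → ℝ) (i : Fin 3) (x : R3) :
    pderiv i (planeWave ζ) x = Complex.I * ζ i * planeWave ζ x := by
  have h : ∀ j : Fin 3, HasFDerivAt (fun x : R3 => ((x j : ℝ) : ℂ))
      (Complex.ofRealCLM ∘L (EuclideanSpace.proj (𝕜 := ℝ) j)) x := fun j =>
    Complex.ofRealCLM.hasFDerivAt.comp x (EuclideanSpace.proj (𝕜 := ℝ) j).hasFDerivAt
  have h1 := ((HasFDerivAt.fun_sum (u := Finset.univ) fun j _ =>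
    (h j).const_mul (ζ j : ℂ)).const_mul Complex.I).cexp
  have h2 : fderiv ℝ (planeWave ζ) x = _ := h1.fderiv
  rw [pderiv, h2]
  fin_cases i <;> simp [planeWave, Fin.sum_univ_three] <;> ring

/-- The `L²(Ω)` norm of a function; it is `0` when the function is measurable of infinite norm. -/
def l2norm (Ω : Set R3) (f : R3 → ℂ) : ℝ :=
  (eLpNorm f 2 (volume.restrict Ω)).toReal

theorem l2norm_nonneg (f : R3 → ℂ) : 0 ≤ l2norm Ω f := ENNReal.toReal_nonneg

theorem l2norm_mul_planeWave (f : R3 → ℂ) (ζ : Fin 3 → ℝ) :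
    l2norm Ω (fun x => f x * planeWave ζ x) = l2norm Ω f :=
  congrArg ENNReal.toReal
    (eLpNorm_congr_norm_ae (.of_forall fun x => by rw [norm_mul, norm_planeWave, mul_one]))

theorem norm_integral_mul_le {a b : R3 → ℂ} (ha : MemLp a 2 (volume.restrict Ω))
    (hb : MemLp b 2 (volume.restrict Ω)) :
    ‖∫ x in Ω, a x * b x‖ ≤ l2norm Ω a * l2norm Ω b := by
  have e : ∫ x in Ω, a x * b x = inner ℂ (ha.star.toLp _) (hb.toLp b) := by
    rw [L2.inner_def]
    refine integral_congr_ae ?_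
    filter_upwards [ha.star.coeFn_toLp, hb.coeFn_toLp] with x h1 h2
    rw [h1, h2]
    simp [mul_comm]
  rw [e]
  refine (norm_inner_le_norm _ _).trans (le_of_eq ?_)
  rw [Lp.norm_toLp, Lp.norm_toLp]
  congr 2
  exact eLpNorm_congr_norm_ae (.of_forall fun x => by simp)

theorem l2norm_grad_apply_le (v : H10 Ω) (i : Fin 3) : l2norm Ω (fun x => grad v x i) ≤ ‖v‖ := by
  refine le_trans ?_ (norm_grad_le v)
  rw [Lp.norm_def]
  exact ENNReal.toReal_mono (Lp.memLp _).eLpNorm_ne_top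
    (eLpNorm_mono fun x => PiLp.norm_apply_le (grad v x) i)

theorem l2norm_fst_le (v : H10 Ω) : l2norm Ω v.1.fst ≤ ‖v‖ := by
  rw [l2norm, ← Lp.norm_def]
  exact WithLp.norm_fst_le (p := 2) (L2 Ω) v.1

theorem norm_integral_grad_mul_le (v : H10 Ω) {χ : R3 → ℂ} (hχ : IsTestFunction Ω χ)
    (ζ : Fin 3 → ℝ) (i : Fin 3) :
    ‖∫ x in Ω, grad v x i * (χ x * planeWave ζ x)‖ ≤ l2norm Ω χ * ‖v‖ := by
  refine (norm_integral_mul_le (memLp_coord (grad v) i)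
    (hχ.mul_contDiff (contDiff_planeWave ζ)).memLp).trans ?_
  rw [l2norm_mul_planeWave, mul_comm]
  exact mul_le_mul_of_nonneg_left (l2norm_grad_apply_le v i) (l2norm_nonneg _)

theorem norm_integral_fst_mul_le (v : H10 Ω) {χ : R3 → ℂ} (hχ : IsTestFunction Ω χ)
    (ζ : Fin 3 → ℝ) :
    ‖∫ x in Ω, v.1.fst x * (χ x * planeWave ζ x)‖ ≤ l2norm Ω χ * ‖v‖ := by
  refine (norm_integral_mul_le (Lp.memLp v.1.fst)
    (hχ.mul_contDiff (contDiff_planeWave ζ)).memLp).trans ?_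
  rw [l2norm_mul_planeWave, mul_comm]
  exact mul_le_mul_of_nonneg_left (l2norm_fst_le v) (l2norm_nonneg _)

theorem pderiv_mul_planeWave {χ : R3 → ℂ} (hχ : IsTestFunction Ω χ) (ζ : Fin 3 → ℝ) (i : Fin 3)
    (x : R3) : pderiv i (fun x => χ x * planeWave ζ x) x =
      pderiv i χ x * planeWave ζ x + Complex.I * ζ i * (χ x * planeWave ζ x) := by
  rw [pderiv_mul (hχ.contDiff.differentiable (by simp))
    ((contDiff_planeWave ζ).differentiable (by simp)), pderiv_planeWave]
  ring

theorem integral_mul_pderiv_mul_planeWave {w χ : R3 → ℂ} (hw : MemLp w 2 (volume.restrict Ω))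
    (hχ : IsTestFunction Ω χ) (ζ : Fin 3 → ℝ) (i : Fin 3) :
    ∫ x in Ω, w x * pderiv i (fun x => χ x * planeWave ζ x) x =
      (∫ x in Ω, w x * (pderiv i χ x * planeWave ζ x)) +
        Complex.I * ζ i * ∫ x in Ω, w x * (χ x * planeWave ζ x) := by
  have h1 := hw.integrable_mul ((hχ.pderiv i).mul_contDiff (contDiff_planeWave ζ)).memLp
  have h2 := (hw.integrable_mul (hχ.mul_contDiff (contDiff_planeWave ζ)).memLp).const_mul
    (Complex.I * ζ i)
  have h3 := integral_add h1 h2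
  simp only [Pi.mul_apply] at h3
  rw [← integral_const_mul, ← h3]
  refine integral_congr_ae (.of_forall fun x => ?_)
  simp only [pderiv_mul_planeWave hχ]
  ring

/-- Integration by parts against a modulated test function `χ exp (i ζ·x)`. -/
theorem integral_grad_mul_planeWave (v : H10 Ω) {χ : R3 → ℂ} (hχ : IsTestFunction Ω χ)
    (ζ : Fin 3 → ℝ) (i : Fin 3) :
    ∫ x in Ω, grad v x i * (χ x * planeWave ζ x) =
      -(∫ x in Ω, v.1.fst x * (pderiv i χ x * planeWave ζ x)) -
        Complex.I * ζ i * ∫ x in Ω, v.1.fst x * (χ x * planeWave ζ x) := by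
  have h1 : HasWeakGradient Ω v.1.fst (grad v) := H10_le_H1 Ω v.2
  have h2 := h1 _ (hχ.mul_contDiff (contDiff_planeWave ζ)) i
  rw [integral_mul_pderiv_mul_planeWave (Lp.memLp v.1.fst) hχ] at h2
  rw [eq_sub_iff_add_eq, eq_neg_iff_add_eq_zero]
  rw [eq_neg_iff_add_eq_zero] at h2
  linear_combination h2

/-- If `ξ` is isotropic for the constant matrix `D = diag d`, then the functionals
`v ↦ ∫ ∇v · D ∇(ψ exp (i n ξ·x))` stay bounded in `H⁻¹(Ω)` as `n → ∞`. The terms of order `n²`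
cancel because `ξ · D ξ = 0`; the terms of order `n` in which `v` is not differentiated lose a
factor `n` through a further integration by parts. -/
theorem exists_bound_isotropic {ψ : R3 → ℂ} (hψ : IsTestFunction Ω ψ) (d ξ : Fin 3 → ℝ)
    (hd : ∑ i, d i * ξ i ^ 2 = 0) {k : Fin 3} (hk : ξ k ≠ 0) :
    ∃ C : ℝ, 0 ≤ C ∧ ∀ (n : ℕ) (v : H10 Ω),
      ‖∫ x in Ω, ∑ i, grad v x i *
        ((d i : ℂ) * pderiv i (fun x => ψ x * planeWave (fun j => n * ξ j) x) x)‖ ≤ C * ‖v‖ := by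
  let N : Fin 3 → ℝ := fun i => l2norm Ω (pderiv i ψ)
  let M : Fin 3 → ℝ := fun i => l2norm Ω (pderiv k (pderiv i ψ))
  refine ⟨∑ i, |d i| * (N i + |ξ i / ξ k| * (N i + M i)),
    Finset.sum_nonneg fun i _ => mul_nonneg (abs_nonneg _) (add_nonneg (l2norm_nonneg _)
      (mul_nonneg (abs_nonneg _) (add_nonneg (l2norm_nonneg _) (l2norm_nonneg _)))),
    fun n v => ?_⟩
  set ζ : Fin 3 → ℝ := fun j => n * ξ j with hζ
  let A : Fin 3 → (R3 → ℂ) → ℂ := fun i χ => ∫ x in Ω, grad v x i * (χ x * planeWave ζ x)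
  let B : (R3 → ℂ) → ℂ := fun χ => ∫ x in Ω, v.1.fst x * (χ x * planeWave ζ x)
  have hAB : ∀ i χ, IsTestFunction Ω χ →
      A i χ = -B (pderiv i χ) - Complex.I * (n * ξ i) * B χ := by
    intro i χ hχ
    have := integral_grad_mul_planeWave v hχ ζ i
    rw [hζ] at this
    push_cast at this
    exact this
  have hsplit : ∫ x in Ω, ∑ i, grad v x i *
      ((d i : ℂ) * pderiv i (fun x => ψ x * planeWave ζ x) x) =
      ∑ i, (d i : ℂ) * (A i (pderiv i ψ) + Complex.I * (n * ξ i) * A i ψ) := by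
    have hi : ∀ i, Integrable (fun x => grad v x i *
        pderiv i (fun x => ψ x * planeWave ζ x) x) (volume.restrict Ω) := fun i =>
      (memLp_coord (grad v) i).integrable_mul
        ((hψ.mul_contDiff (contDiff_planeWave ζ)).memLp_pderiv i)
    have hi' : ∀ i, Integrable (fun x => grad v x i *
        ((d i : ℂ) * pderiv i (fun x => ψ x * planeWave ζ x) x)) (volume.restrict Ω) := fun i =>
      ((hi i).const_mul (d i : ℂ)).congr (.of_forall fun x => by ring)
    rw [integral_finsetSum _ fun i _ => hi' i]
    refine Finset.sum_congr rfl fun i _ => ?_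
    have h1 := integral_mul_pderiv_mul_planeWave (memLp_coord (grad v) i) hψ ζ i
    rw [hζ] at h1
    push_cast at h1
    rw [← h1, ← integral_const_mul]
    refine integral_congr_ae (.of_forall fun x => ?_)
    simp only
    ring
  have hk' : (ξ k : ℂ) ≠ 0 := by exact_mod_cast hk
  have hdC : ∑ i, (d i : ℂ) * (ξ i : ℂ) ^ 2 = 0 := by exact_mod_cast hd
  -- Substitute the integration by parts formula for `A i ψ`: its `n²` term cancels in the sum,
  -- and the same formula for `∂ᵢψ` in the direction `k` removes the remaining factor `n`.
  have hmain : ∑ i, (d i : ℂ) * (A i (pderiv i ψ) + Complex.I * (n * ξ i) * A i ψ) =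
      ∑ i, (d i : ℂ) * (A i (pderiv i ψ) +
        (ξ i / ξ k : ℂ) * (A k (pderiv i ψ) + B (pderiv k (pderiv i ψ)))) := by
    have h1 : ∀ i, (d i : ℂ) * (A i (pderiv i ψ) + Complex.I * (n * ξ i) * A i ψ) =
        (d i : ℂ) * (A i (pderiv i ψ) +
          (ξ i / ξ k : ℂ) * (A k (pderiv i ψ) + B (pderiv k (pderiv i ψ)))) +
          (d i : ℂ) * (ξ i : ℂ) ^ 2 * ((n : ℂ) ^ 2 * B ψ) := by
      intro i
      rw [hAB i ψ hψ, hAB k (pderiv i ψ) (hψ.pderiv i)]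
      field_simp
      linear_combination -((d i : ℂ) * (n : ℂ) ^ 2 * (ξ i : ℂ) ^ 2 * B ψ * ξ k) * Complex.I_sq
    rw [Finset.sum_congr rfl fun i _ => h1 i, Finset.sum_add_distrib, ← Finset.sum_mul, hdC,
      zero_mul, add_zero]
  rw [hsplit, hmain, Finset.sum_mul]
  refine (norm_sum_le _ _).trans (Finset.sum_le_sum fun i _ => ?_)
  have b1 := norm_integral_grad_mul_le v (hψ.pderiv i) ζ i
  have b2 := norm_integral_grad_mul_le v (hψ.pderiv i) ζ k
  have b3 := norm_integral_fst_mul_le v ((hψ.pderiv i).pderiv k) ζ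
  have e : ‖(ξ i / ξ k : ℂ)‖ = |ξ i / ξ k| := by
    rw [← Complex.ofReal_div, Complex.norm_real, Real.norm_eq_abs]
  calc ‖(d i : ℂ) * (A i (pderiv i ψ) +
        (ξ i / ξ k : ℂ) * (A k (pderiv i ψ) + B (pderiv k (pderiv i ψ))))‖
      ≤ |d i| * (N i * ‖v‖ + |ξ i / ξ k| * (N i * ‖v‖ + M i * ‖v‖)) := by
        rw [norm_mul, Complex.norm_real, Real.norm_eq_abs]
        refine mul_le_mul_of_nonneg_left ((norm_add_le _ _).trans (add_le_add b1 ?_))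
          (abs_nonneg _)
        rw [norm_mul, e]
        exact mul_le_mul_of_nonneg_left ((norm_add_le _ _).trans (add_le_add b2 b3))
          (abs_nonneg _)
    _ = |d i| * (N i + |ξ i / ξ k| * (N i + M i)) * ‖v‖ := by ring

theorem l2norm_pos_of_ne_zero {ψ : R3 → ℂ} (hO : IsOpen Ω) (hψ : IsTestFunction Ω ψ) {x₀ : R3}
    (h0 : ψ x₀ ≠ 0) : 0 < l2norm Ω ψ := by
  refine ENNReal.toReal_pos (fun h => h0 ?_) hψ.memLp.eLpNorm_ne_top
  rw [← eLpNorm_indicator_eq_eLpNorm_restrict hO.measurableSet,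
    Set.indicator_eq_self.2 ((subset_tsupport ψ).trans hψ.tsupport_subset),
    eLpNorm_eq_zero_iff hψ.contDiff.continuous.aestronglyMeasurable (by norm_num)] at h
  exact congrFun ((hψ.contDiff.continuous.ae_eq_iff_eq volume continuous_const).1 h) x₀

/-- Modulated test functions have a norm growing at least linearly in the frequency. -/
theorem mul_l2norm_sub_le_norm_toH10 {ψ : R3 → ℂ} (hψ : IsTestFunction Ω ψ) (ζ : Fin 3 → ℝ)
    (k : Fin 3) : |ζ k| * l2norm Ω ψ - l2norm Ω (pderiv k ψ) ≤
      ‖(hψ.mul_contDiff (contDiff_planeWave ζ)).toH10‖ := by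
  have hT := hψ.mul_contDiff (contDiff_planeWave ζ)
  have hT' := (hψ.pderiv k).mul_contDiff (contDiff_planeWave ζ)
  have h1 : l2norm Ω (pderiv k fun x => ψ x * planeWave ζ x) ≤ ‖hT.toH10‖ := by
    refine le_of_eq_of_le ?_ (l2norm_grad_apply_le hT.toH10 k)
    refine congrArg ENNReal.toReal (eLpNorm_congr_ae ?_)
    filter_upwards [hT.grad_toH10] with x hx
    rw [hx]
    rfl
  have h2 : |ζ k| * l2norm Ω ψ =
      l2norm Ω ((pderiv k fun x => ψ x * planeWave ζ x) -
        fun x => pderiv k ψ x * planeWave ζ x) := by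
    have e : ((pderiv k fun x => ψ x * planeWave ζ x) - fun x => pderiv k ψ x * planeWave ζ x) =
        (Complex.I * ζ k) • fun x => ψ x * planeWave ζ x := by
      ext x
      simp only [Pi.sub_apply, pderiv_mul_planeWave hψ, Pi.smul_apply, smul_eq_mul]
      ring
    have h := l2norm_mul_planeWave (Ω := Ω) ψ ζ
    rw [e, ← h, l2norm, l2norm, eLpNorm_const_smul, ENNReal.toReal_mul]
    simp
  have h3 : l2norm Ω ((pderiv k fun x => ψ x * planeWave ζ x) -
        fun x => pderiv k ψ x * planeWave ζ x) ≤
      l2norm Ω (pderiv k fun x => ψ x * planeWave ζ x) +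
        l2norm Ω (fun x => pderiv k ψ x * planeWave ζ x) := by
    have a1 := (hT.memLp_pderiv k)
    have a2 := hT'.memLp
    rw [l2norm, l2norm, l2norm, ← ENNReal.toReal_add a1.eLpNorm_ne_top a2.eLpNorm_ne_top]
    exact ENNReal.toReal_mono (ENNReal.add_ne_top.2 ⟨a1.eLpNorm_ne_top, a2.eLpNorm_ne_top⟩)
      (eLpNorm_sub_le a1.1 a2.1 (by norm_num))
  rw [l2norm_mul_planeWave] at h3
  linarith

/-! ### Non-invertibility on the convex hull -/

/-- A real diagonal quadratic form with entries of both signs has an isotropic vector. -/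
theorem exists_isotropic_vector {ι : Type*} [Fintype ι] [DecidableEq ι] (d : ι → ℝ) {i j : ι}
    (hi : d i ≤ 0) (hj : 0 ≤ d j) :
    ∃ ξ : ι → ℝ, ∑ m, d m * ξ m ^ 2 = 0 ∧ ∃ k, ξ k ≠ 0 := by
  have hsingle : ∀ k, d k = 0 → ∃ ξ : ι → ℝ, ∑ m, d m * ξ m ^ 2 = 0 ∧ ∃ k, ξ k ≠ 0 := by
    intro k hk
    refine ⟨Pi.single k 1, Finset.sum_eq_zero fun m _ => ?_, k, by simp⟩
    rcases eq_or_ne m k with rfl | h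
    · rw [hk, zero_mul]
    · simp [h]
  rcases hi.eq_or_lt with h | hi
  · exact hsingle i h
  rcases hj.eq_or_lt with h | hj
  · exact hsingle j h.symm
  have hij : i ≠ j := by
    rintro rfl
    linarith
  refine ⟨Pi.single i (√(d j)) + Pi.single j (√(-d i)), ?_, i, ?_⟩
  · rw [Fintype.sum_eq_add i j hij]
    · simp only [Pi.add_apply, Pi.single_eq_same, Pi.single_eq_of_ne hij,
        Pi.single_eq_of_ne hij.symm, add_zero, zero_add]
      rw [Real.sq_sqrt hj.le, Real.sq_sqrt (by linarith)]
      ring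
    · rintro m ⟨h1, h2⟩
      simp [h1, h2]
  · simpa [hij] using (Real.sqrt_pos.2 hj).ne'

/-- The form with small coefficients `a` is small; the coefficients only matter where `∇u ≠ 0`. -/
theorem norm_integral_perturbation_le {ε : ℝ} (hε : 0 ≤ ε) (u v : H10 Ω) (a : Fin 3 → R3 → ℂ)
    (ha : ∀ᵐ x ∂(volume.restrict Ω), (∀ m, ‖a m x‖ ≤ ε) ∨ grad u x = 0) :
    ‖∫ x in Ω, ∑ m, grad v x m * (a m x * grad u x m)‖ ≤ 3 * ε * (‖v‖ * ‖u‖) := by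
  have hint : Integrable (fun x => ‖grad v x‖ * ‖grad u x‖) (volume.restrict Ω) :=
    (Lp.memLp (grad v)).norm.integrable_mul (Lp.memLp (grad u)).norm
  refine (norm_integral_le_of_norm_le (hint.const_mul (3 * ε)) ?_).trans ?_
  · filter_upwards [ha] with x hx
    rcases hx with hx | hx
    · calc ‖∑ m, grad v x m * (a m x * grad u x m)‖
          ≤ ∑ _m : Fin 3, ‖grad v x‖ * (ε * ‖grad u x‖) := by
            refine (norm_sum_le _ _).trans (Finset.sum_le_sum fun m _ => ?_)
            rw [norm_mul, norm_mul]
            gcongr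
            · exact PiLp.norm_apply_le _ m
            · exact hx m
            · exact PiLp.norm_apply_le _ m
        _ = 3 * ε * (‖grad v x‖ * ‖grad u x‖) := by
            rw [Finset.sum_const, Finset.card_univ, Fintype.card_fin, nsmul_eq_mul]
            push_cast
            ring
    · simp [hx]
  · rw [integral_const_mul]
    refine mul_le_mul_of_nonneg_left ((integral_norm_mul_norm_le _ _).trans ?_) (by positivity)
    exact mul_le_mul (norm_grad_le v) (norm_grad_le u) (norm_nonneg _) (norm_nonneg _)

/-- An invertible operator `T` bounds `u` by any error `C` in an estimate of `T u` that is
affine in `‖u‖` with a small slope. -/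
theorem exists_bound_of_isInvertible {E F : Type*} [NormedAddCommGroup E] [NormedSpace ℂ E]
    [NormedAddCommGroup F] [NormedSpace ℂ F] {T : E →L[ℂ] StrongDual ℂ F} (hT : T.IsInvertible) :
    ∃ ε K : ℝ, 0 < ε ∧ ∀ (u : E) (C : ℝ), ‖T u‖ ≤ C + 3 * ε * ‖u‖ → ‖u‖ ≤ K * C := by
  let K : ℝ := ‖T.inverse‖ + 1
  have hK : 0 < K := by positivity
  have hbelow : ∀ u, ‖u‖ ≤ K * ‖T u‖ := fun u => by
    calc ‖u‖ = ‖T.inverse (T u)‖ := by rw [hT.inverse_apply_self]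
      _ ≤ ‖T.inverse‖ * ‖T u‖ := T.inverse.le_opNorm _
      _ ≤ (‖T.inverse‖ + 1) * ‖T u‖ := by gcongr; linarith
  -- With this `ε` the term `3 * ε * ‖u‖` contributes `‖u‖ / 2`, which is absorbed on the left.
  refine ⟨1 / (6 * K), 2 * K, by positivity, fun u C h => ?_⟩
  have h2 := (hbelow u).trans (mul_le_mul_of_nonneg_left h hK.le)
  have h4 : K * (C + 3 * (1 / (6 * K)) * ‖u‖) = K * C + 1 / 2 * ‖u‖ := by
    field_simp
    ring
  linarith

/-- Freezing the coefficients at `p` changes `r ℒ - 𝒜` by little on functions supported where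
the coefficients are close to their values at `p`. -/
theorem norm_shift_toH10_le {κ : Fin 3 → R3 → ℝ} (hκ : ∀ i, MemLp (κ i) ⊤ (volume.restrict Ω))
    {φ : R3 → ℂ} (hφ : IsTestFunction Ω φ) {p : R3} {r ε C : ℝ} (hε : 0 ≤ ε) (hC : 0 ≤ C)
    (hκε : ∀ x ∈ tsupport φ, ∀ m, |κ m p - κ m x| ≤ ε)
    (hbound : ∀ v : H10 Ω, ‖∫ x in Ω, ∑ m, grad v x m *
      (((r - κ m p : ℝ) : ℂ) * pderiv m φ x)‖ ≤ C * ‖v‖) :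
    ‖((r : ℂ) • opL Ω - opA Ω κ hκ) hφ.toH10‖ ≤ C + 3 * ε * ‖hφ.toH10‖ := by
  refine ContinuousLinearMap.opNorm_le_bound _ (by positivity) fun v => ?_
  have hgrad := hφ.grad_toH10
  generalize hφ.toH10 = u at hgrad ⊢
  have e1 : ∫ x in Ω, ∑ m, grad v x m * (((r - κ m p : ℝ) : ℂ) * pderiv m φ x) =
      ∫ x in Ω, ∑ m, grad v x m * ((r - κ m p : ℂ) * grad u x m) := by
    refine integral_congr_ae ?_
    filter_upwards [hgrad] with x hx
    refine Finset.sum_congr rfl fun m _ => ?_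
    rw [hx, Complex.ofReal_sub]
    rfl
  have hdec : ((r : ℂ) • opL Ω - opA Ω κ hκ) u v =
      (∫ x in Ω, ∑ m, grad v x m * (((r - κ m p : ℝ) : ℂ) * pderiv m φ x)) +
      ∫ x in Ω, ∑ m, grad v x m * ((κ m p - κ m x : ℂ) * grad u x m) := by
    have i1 := shift_integrable hκ (r : ℂ) (grad u) (grad v)
    have i2 := shift_integrable (κ := fun m _ => κ m p) (fun _ => memLp_top_const _) (r : ℂ)
      (grad u) (grad v)
    have e2 : ∀ x, (∑ m, grad v x m * ((κ m p - κ m x : ℂ) * grad u x m)) =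
        (∑ m, grad v x m * ((r - κ m x : ℂ) * grad u x m)) -
        ∑ m, grad v x m * ((r - κ m p : ℂ) * grad u x m) := by
      intro x
      rw [← Finset.sum_sub_distrib]
      refine Finset.sum_congr rfl fun m _ => ?_
      ring
    simp only [e2]
    rw [e1, shift_apply, integral_sub i1 i2]
    ring
  have hsmall : ‖∫ x in Ω, ∑ m, grad v x m * ((κ m p - κ m x : ℂ) * grad u x m)‖ ≤
      3 * ε * (‖v‖ * ‖u‖) := by
    refine norm_integral_perturbation_le hε u v (fun m x => κ m p - κ m x) ?_
    filter_upwards [hgrad] with x hx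
    by_cases hxU : x ∈ tsupport φ
    · refine Or.inl fun m => ?_
      rw [← Complex.ofReal_sub, Complex.norm_real]
      exact hκε x hxU m
    · refine Or.inr ?_
      rw [hx]
      ext m
      exact image_eq_zero_of_notMem_tsupport (f := pderiv m φ) fun h => hxU
        (tsupport_fderiv_apply_subset ℝ (EuclideanSpace.single m 1) h)
  rw [hdec]
  refine (norm_add_le _ _).trans ((add_le_add (hbound v) hsmall).trans (le_of_eq ?_))
  ring

/-- The point `p` may lie on the boundary; the test function is then centred at a nearby point of
`Ω`. -/
theorem exists_testFunction_near (hO : IsOpen Ω) {κ : Fin 3 → R3 → ℝ}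
    (hc : ∀ i, ContinuousOn (κ i) (closure Ω)) {p : R3} (hp : p ∈ closure Ω) {ε : ℝ}
    (hε : 0 < ε) : ∃ ψ : R3 → ℂ, IsTestFunction Ω ψ ∧ (∃ x₀, ψ x₀ ≠ 0) ∧
      ∀ x ∈ tsupport ψ, ∀ m, |κ m p - κ m x| ≤ ε := by
  have h1 : ∀ᶠ x in 𝓝[closure Ω] p, ∀ m, |κ m p - κ m x| < ε := by
    refine Filter.eventually_all.2 fun m => ?_
    filter_upwards [(hc m p hp) (Metric.ball_mem_nhds _ hε)] with x hx
    rw [abs_sub_comm]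
    exact hx
  obtain ⟨V, hV, hVp, hVε⟩ := mem_nhdsWithin.1 h1
  obtain ⟨x₀, hx₀V, hx₀⟩ := mem_closure_iff.1 hp V hV hVp
  obtain ⟨χ, hχU, hχc, hχs, -, hχ1⟩ := exists_contDiff_tsupport_subset (n := ⊤)
    ((hV.inter hO).mem_nhds ⟨hx₀V, hx₀⟩)
  have hψt : tsupport (fun x => (χ x : ℂ)) ⊆ V ∩ Ω := by
    refine (closure_mono fun x hx => ?_).trans hχU
    simpa using hx
  exact ⟨fun x => (χ x : ℂ), ⟨Complex.ofRealCLM.contDiff.comp hχs,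
    hχc.comp_left Complex.ofReal_zero, hψt.trans Set.inter_subset_right⟩, ⟨x₀, by simp [hχ1]⟩,
    fun x hx m => (hVε ⟨(hψt hx).1, subset_closure (hψt hx).2⟩ m).le⟩

/-- If `r` lies between two diagonal entries of `K` at some point `p` of the closure of `Ω`,
then functions oscillating near `p` in a direction isotropic for `r I - K(p)` show that
`r ℒ - 𝒜` is not bounded below. -/
theorem not_isInvertible_shift (hO : IsOpen Ω) {κ : Fin 3 → R3 → ℝ}
    (hκ : ∀ i, MemLp (κ i) ⊤ (volume.restrict Ω)) (hc : ∀ i, ContinuousOn (κ i) (closure Ω))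
    {p : R3} (hp : p ∈ closure Ω) {r : ℝ} {i j : Fin 3} (hi : κ i p ≤ r) (hj : r ≤ κ j p) :
    ¬ ((r : ℂ) • opL Ω - opA Ω κ hκ).IsInvertible := by
  intro hinv
  obtain ⟨ξ, hξ, k, hk⟩ := exists_isotropic_vector (fun m => r - κ m p) (i := j) (j := i)
    (by linarith) (by linarith)
  obtain ⟨ε, M, hε, hM⟩ := exists_bound_of_isInvertible hinv
  obtain ⟨ψ, hψ, ⟨x₀, hx₀⟩, hψε⟩ := exists_testFunction_near hO hc hp hε
  obtain ⟨C, hC, hbound⟩ := exists_bound_isotropic hψ (fun m => r - κ m p) ξ hξ hk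
  have hest : ∀ n : ℕ, n * (|ξ k| * l2norm Ω ψ) - l2norm Ω (pderiv k ψ) ≤ M * C := by
    intro n
    have h1 := hM _ C (norm_shift_toH10_le hκ (hψ.mul_contDiff (contDiff_planeWave _)) hε.le hC
      (fun x hx => hψε x (tsupport_mul_subset_left (f := ψ) hx)) (hbound n))
    refine le_trans (le_of_eq ?_) ((mul_l2norm_sub_le_norm_toH10 hψ (fun j => n * ξ j) k).trans h1)
    rw [abs_mul, Nat.abs_cast, mul_assoc]
  have hpos : 0 < |ξ k| * l2norm Ω ψ :=
    mul_pos (abs_pos.2 hk) (l2norm_pos_of_ne_zero hO hψ hx₀)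
  obtain ⟨n, hn⟩ := exists_nat_gt ((M * C + l2norm Ω (pderiv k ψ)) / (|ξ k| * l2norm Ω ψ))
  rw [div_lt_iff₀ hpos] at hn
  linarith [hest n]

/-! ### Convex hulls of ranges of continuous functions -/

/-- On a connected set, the convex hull of the ranges of finitely many continuous functions is
covered by the intervals spanned by their values at single points. -/
theorem exists_between_of_mem_convexHull {X ι : Type*} [TopologicalSpace X] [Fintype ι]
    [Nonempty ι] {s : Set X} (hs : IsPreconnected s) {κ : ι → X → ℝ}
    (hc : ∀ i, ContinuousOn (κ i) s) {l : ℂ}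
    (hl : l ∈ convexHull ℝ (⋃ i, (fun x => (κ i x : ℂ)) '' s)) :
    ∃ r : ℝ, l = r ∧ ∃ p ∈ s, (∃ i, κ i p ≤ r) ∧ ∃ j, r ≤ κ j p := by
  let Q : Set ℝ := {r | ∃ p ∈ s, (∃ i, κ i p ≤ r) ∧ ∃ j, r ≤ κ j p}
  have hQ : Q.OrdConnected := by
    refine ⟨?_⟩
    rintro a ⟨p, hp, ⟨i, hi⟩, -⟩ b ⟨q, hq, -, ⟨j, hj⟩⟩ r ⟨har, hrb⟩
    -- Apply the intermediate value theorem to the maximum of the functions.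
    let M : X → ℝ := fun x => Finset.univ.sup' Finset.univ_nonempty fun i => κ i x
    have hM : ContinuousOn M s := ContinuousOn.finset_sup'_apply _ fun i _ => hc i
    have hattain : ∀ x, ∃ m, M x = κ m x := fun x => by
      obtain ⟨m, -, hm⟩ := Finset.exists_mem_eq_sup' Finset.univ_nonempty fun i => κ i x
      exact ⟨m, hm⟩
    have hle : ∀ m x, κ m x ≤ M x := fun m x =>
      Finset.le_sup' (fun i => κ i x) (Finset.mem_univ m)
    rcases le_or_gt r (M p) with h | h
    · obtain ⟨m, hm⟩ := hattain p
      exact ⟨p, hp, ⟨i, hi.trans har⟩, m, hm ▸ h⟩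
    · obtain ⟨x, hx, hxr⟩ := hs.intermediate_value hp hq hM
        ⟨h.le, hrb.trans (hj.trans (hle j q))⟩
      obtain ⟨m, hm⟩ := hattain x
      exact ⟨x, hx, ⟨m, (hm.symm.trans hxr).le⟩, m, (hm.symm.trans hxr).ge⟩
  have hconv : Convex ℝ (Complex.ofRealCLM '' Q) :=
    hQ.convex.linear_image Complex.ofRealCLM.toLinearMap
  have hsub : (⋃ i, (fun x => (κ i x : ℂ)) '' s) ⊆ Complex.ofRealCLM '' Q := by
    rintro _ ⟨_, ⟨i, rfl⟩, x, hx, rfl⟩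
    exact ⟨κ i x, ⟨x, hx, ⟨i, le_rfl⟩, i, le_rfl⟩, rfl⟩
  obtain ⟨r, hr, rfl⟩ := convexHull_min hsub hconv hl
  exact ⟨r, rfl, hr⟩

/-- The convex hull of the values of finitely many real continuous functions on a compact set
contains the interval between the least and the greatest value. -/
theorem exists_closed_convex_subset_convexHull {X ι : Type*} [TopologicalSpace X] [Finite ι]
    [Nonempty ι] {s : Set X} (hs : IsCompact s) (hne : s.Nonempty) {κ : ι → X → ℝ}
    (hc : ∀ i, ContinuousOn (κ i) s) :
    ∃ S : Set ℂ, Convex ℝ S ∧ IsClosed S ∧ (∀ i, ∀ x ∈ s, (κ i x : ℂ) ∈ S) ∧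
      S ⊆ convexHull ℝ (⋃ i, (fun x => (κ i x : ℂ)) '' s) := by
  have hV : IsCompact (⋃ i, κ i '' s) := isCompact_iUnion fun i => hs.image_of_continuousOn (hc i)
  have hVne : (⋃ i, κ i '' s).Nonempty :=
    Set.nonempty_iUnion.2 ⟨Classical.arbitrary ι, hne.image _⟩
  have hVhull : ∀ t ∈ ⋃ i, κ i '' s, (t : ℂ) ∈ convexHull ℝ (⋃ i, (fun x => (κ i x : ℂ)) '' s) := by
    rintro _ ⟨_, ⟨i, rfl⟩, x, hx, rfl⟩
    exact subset_convexHull ℝ _ ⟨_, ⟨i, rfl⟩, x, hx, rfl⟩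
  obtain ⟨a, ha⟩ := hV.exists_isLeast hVne
  obtain ⟨b, hb⟩ := hV.exists_isGreatest hVne
  refine ⟨Complex.ofRealCLM '' Set.Icc a b,
    (convex_Icc a b).linear_image Complex.ofRealCLM.toLinearMap,
    (isCompact_Icc.image Complex.ofRealCLM.continuous).isClosed, fun i x hx => ?_, ?_⟩
  · have hm : κ i x ∈ ⋃ i, κ i '' s := Set.mem_iUnion.2 ⟨i, x, hx, rfl⟩
    exact ⟨κ i x, ⟨ha.2 hm, hb.2 hm⟩, rfl⟩
  · rw [← segment_eq_Icc (ha.2 hb.1)]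
    have h := image_segment ℝ Complex.ofRealCLM.toLinearMap.toAffineMap a b
    refine h.subset.trans ?_
    exact (convex_convexHull ℝ _).segment_subset (hVhull a ha.1) (hVhull b hb.1)

end

end GenSpectrum

end

theorem mainTheorem1 (Ω : Set GenSpectrum.R3) (hΩ : GenSpectrum.IsBoundedLipschitzDomain Ω)
    (κ : Fin 3 → GenSpectrum.R3 → ℝ) (hκ : ∀ i, ContinuousOn (κ i) (closure Ω)) :
    (GenSpectrum.opL Ω).IsInvertible ∧
      spectrum ℂ (GenSpectrum.precond Ω κ fun i =>
          GenSpectrum.memLp_top_of_continuousOn_closure hΩ.isOpen hΩ.isBounded (hκ i)) =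
        convexHull ℝ (⋃ i, (fun x => (κ i x : ℂ)) '' closure Ω) := by
  have hL := GenSpectrum.opL_isInvertible hΩ.isOpen hΩ.isBounded
  refine ⟨hL, Set.ext fun l => ?_⟩
  rw [GenSpectrum.mem_spectrum_precond_iff hL]
  constructor
  · intro h
    by_contra hl
    have hne : (closure Ω).Nonempty := hΩ.isConnected.nonempty.closure
    obtain ⟨S, hS, hSc, hκS, hsub⟩ := GenSpectrum.exists_closed_convex_subset_convexHull
      hΩ.isBounded.isCompact_closure hne hκ
    exact h (GenSpectrum.shift_isInvertible_of_notMem hΩ.isOpen hΩ.isBounded _ hS hSc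
      (fun i x hx => hκS i x (subset_closure hx)) fun hlS => hl (hsub hlS))
  · intro hl
    obtain ⟨r, rfl, p, hp, ⟨i, hi⟩, j, hj⟩ := GenSpectrum.exists_between_of_mem_convexHull
      hΩ.isConnected.isPreconnected.closure hκ hl
    exact GenSpectrum.not_isInvertible_shift hΩ.isOpen _ hκ hp hi hj
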